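/- Theorem (Generalized Van Kampen's Theorem). Let $X$ be a polyhedron, i.e. a space with a homeomorphism $|K|\cong X$, where $K$ is a (possibly infinite) simplicial complex and $|K|$ carries the weak topology. Let $A$ and $B$ be subpolyhedra of $X$ (each is the underlying set of a subcomplex of some subdivision of $K$) such that $A\cup B=X$ and $A\cap B=\bigsqcup_{i=0}^n C_i$ is a disjoint union, as a topological space, of path connected nonempty subspaces $C_0,\dots,C_n$. For each $i$ choose a base point $c_i\in C_i$. For $1\le i\le n$ let $t_i^A$ be a path from $c_0$ to $c_i$ in $A$ and $t_i^B$ a path from $c_0$ to $c_i$ in $B$; let $t_0^A,t_0^B$ be the constant paths at $c_0$. Write products of paths from left to right ($pq$ is first $p$, then $q$), also in fundamental groups, and write $p^{-1}$ for the reverse of a path $p$. For $0\le i\le n$ define homomorphisms $$j_i^A:\pi_1(C_i,c_i)\to\pi_1(A,c_0),\quad [\sigma]\mapsto[t_i^A\,\sigma\,(t_i^A)^{-1}],\qquad j_i^B:\pi_1(C_i,c_i)\to\pi_1(B,c_0),\quad [\sigma]\mapsto[t_i^B\,\sigma\,(t_i^B)^{-1}].$$ Let $F(t_1,\dots,t_n)$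 be the free group on the letters $t_1,\dots,t_n$, let $t_0=1$, and let $N$ be the smallest normal subgroup of $\pi_1(A,c_0)*\pi_1(B,c_0)*F(t_1,\dots,t_n)$ that contains all words $$j_i^A([\sigma])\,\bigl(t_i\,j_i^B([\sigma])\,t_i^{-1}\bigr)^{-1},\qquad 0\le i\le n,\ [\sigma]\in\pi_1(C_i,c_i).$$ Then there is an isomorphism $$\Phi:\ \bigl(\pi_1(A,c_0)*\pi_1(B,c_0)*F(t_1,\dots,t_n)\bigr)/N\ \longrightarrow\ \pi_1(X,c_0)$$ with $\Phi(\alpha)=i^A\alpha$ for all $\alpha\in\pi_1(A,c_0)$, $\Phi(\beta)=i^B\beta$ for all $\beta\in\pi_1(B,c_0)$, and $\Phi(t_i)=[t_i^A(t_i^B)^{-1}]$ for $1\le i\le n$, where $i^A$ and $i^B$ are the homomorphisms induced by the inclusions of $A$ and $B$ into $X$. -/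

import Mathlib

open Set

section PolyhedronDefs

open Geometry

variable {E : Type*} [AddCommGroup E] [Module ℝ E]

/-- The underlying space `|K|` of a (possibly infinite) simplicial complex `K`. It is a type
synonym of the subtype `K.space`, so that it carries the weak topology below and no other. -/
def Polyhedron (K : SimplicialComplex ℝ E) : Type _ := K.space

/-- The characteristic map of a face `s` of `K`: the point with barycentric coordinates `w` is
sent to `∑ v ∈ s, w v • v`. -/
def Polyhedron.simplexMap (K : SimplicialComplex ℝ E) (s : K.faces)
    (w : stdSimplex ℝ (s : Finset E)) : Polyhedron K :=
  ⟨∑ v : (s : Finset E), w.1 v • (v : E),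
    SimplicialComplex.convexHull_subset_space s.2
      ((convex_convexHull ℝ (s : Set E)).sum_mem (fun v _ => w.2.1 v) w.2.2
        (fun v _ => subset_convexHull ℝ _ v.2))⟩

/-- The weak topology of `|K|`: a set is open iff its preimage under the characteristic map of
every face is open in the standard simplex. -/
instance Polyhedron.instTopologicalSpace (K : SimplicialComplex ℝ E) :
    TopologicalSpace (Polyhedron K) :=
  ⨆ s : K.faces, TopologicalSpace.coinduced (Polyhedron.simplexMap K s) inferInstance

/-- `K'` is a subdivision of `K`: every simplex of `K'` lies in a simplex of `K`, and every simplex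
of `K` is a union of finitely many simplices of `K'`. -/
def IsSubdivision (K' K : SimplicialComplex ℝ E) : Prop :=
  (∀ t ∈ K'.faces, ∃ s ∈ K.faces, convexHull ℝ (t : Set E) ⊆ convexHull ℝ (s : Set E)) ∧
  (∀ s ∈ K.faces, ∃ F : Finset (Finset E), (∀ t ∈ F, t ∈ K'.faces) ∧
    convexHull ℝ (s : Set E) = ⋃ t ∈ F, convexHull ℝ (t : Set E))

/-- Let `X` be a polyhedron, triangulated by `h : |K| ≃ₜ X`. A subset `A` of `X` is a subpolyhedron
if it corresponds to the underlying set of a subcomplex `L` of some subdivision `K'` of `K`. -/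
def IsSubpolyhedron {X : Type*} [TopologicalSpace X] {K : SimplicialComplex ℝ E}
    (h : Polyhedron K ≃ₜ X) (A : Set X) : Prop :=
  ∃ K' L : SimplicialComplex ℝ E, IsSubdivision K' K ∧ L.faces ⊆ K'.faces ∧
    ∀ x : Polyhedron K, h x ∈ A ↔ x.1 ∈ L.space

end PolyhedronDefs

/-- The subset `S` of a space is the disjoint union `⊔ i, C i`, as a topological space: the `C i`
are pairwise disjoint, they cover `S`, and each of them is open in `S`. -/
structure IsTopDisjointUnion {X ι : Type*} [TopologicalSpace X] (S : Set X) (C : ι → Set X) :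
    Prop where
  iUnion_eq : ⋃ i, C i = S
  disjoint : Pairwise fun i j => Disjoint (C i) (C j)
  isOpen : ∀ i, IsOpen ((↑) ⁻¹' C i : Set S)

theorem IsTopDisjointUnion.subset_left {X ι : Type*} [TopologicalSpace X] {A B : Set X}
    {C : ι → Set X} (h : IsTopDisjointUnion (A ∩ B) C) (i : ι) : C i ⊆ A :=
  fun _ hx => (h.iUnion_eq ▸ mem_iUnion_of_mem i hx : _ ∈ A ∩ B).1

theorem IsTopDisjointUnion.subset_right {X ι : Type*} [TopologicalSpace X] {A B : Set X}
    {C : ι → Set X} (h : IsTopDisjointUnion (A ∩ B) C) (i : ι) : C i ⊆ B :=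
  fun _ hx => (h.iUnion_eq ▸ mem_iUnion_of_mem i hx : _ ∈ A ∩ B).2

section LoopGroups

variable {X Y : Type*} [TopologicalSpace X] [TopologicalSpace Y]

/-- The fundamental group `π₁(X, x)` with the multiplication `[p][q] = [first p, then q]`. In
Mathlib's `FundamentalGroup X x` the product is taken in the other order, hence the opposite. -/
abbrev LoopGroup (X : Type*) [TopologicalSpace X] (x : X) : Type _ := (FundamentalGroup X x)ᵐᵒᵖ

/-- The class of a loop in the fundamental group. -/
def loopClass {x : X} (p : Path x x) : LoopGroup X x :=
  MulOpposite.op (FundamentalGroup.fromPath (Path.Homotopic.Quotient.mk p))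

theorem loopClass_trans {x : X} (p q : Path x x) :
    loopClass (p.trans q) = loopClass p * loopClass q := rfl

theorem loopClass_symm {x : X} (p : Path x x) : loopClass p.symm = (loopClass p)⁻¹ := rfl

/-- The homomorphism `π₁(A, a) → π₁(X, a)` induced by the inclusion of `A` into `X`. -/
noncomputable def LoopGroup.ofSubset (A : Set X) (a : A) : LoopGroup A a →* LoopGroup X (a : X) :=
  MonoidHom.op (FundamentalGroup.map ⟨((↑) : A → X), continuous_subtype_val⟩ a)

theorem LoopGroup.ofSubset_loopClass (A : Set X) (a : A) (p : Path a a) :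
    LoopGroup.ofSubset A a (loopClass p) = loopClass (p.map continuous_subtype_val) := rfl

/-- For `C ⊆ A` and a path `t` in `A` from `a` to `c ∈ C`, the homomorphism
`π₁(C, c) → π₁(A, a)`, `[σ] ↦ [first t, then σ, then the reverse of t]`: the map induced by the
inclusion, followed by the change of base point along `t`. -/
noncomputable def LoopGroup.inclusionAlong {C A : Set X} (hCA : C ⊆ A) (c : C) {a : A}
    (t : Path a (inclusion hCA c)) : LoopGroup C c →* LoopGroup A a :=
  MonoidHom.op
    ((FundamentalGroup.fundamentalGroupMulEquivOfPath t.symm).toMonoidHom.comp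
      (FundamentalGroup.map (ContinuousMap.inclusion hCA) c))

theorem LoopGroup.inclusionAlong_loopClass {C A : Set X} (hCA : C ⊆ A) (c : C) {a : A}
    (t : Path a (inclusion hCA c)) (σ : Path c c) :
    LoopGroup.inclusionAlong hCA c t (loopClass σ) =
      loopClass (t.trans ((σ.map (continuous_inclusion hCA)).trans t.symm)) := by
  refine congrArg MulOpposite.op
    ((CategoryTheory.Iso.conj_apply _ _).trans ?_)
  have key : CategoryTheory.Iso.inv ((CategoryTheory.Groupoid.isoEquivHom
      (FundamentalGroupoid.mk (inclusion hCA c)) (FundamentalGroupoid.mk a)).symm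
        (Path.Homotopic.Quotient.mk t.symm)) = Path.Homotopic.Quotient.mk t := by
    conv_rhs => rw [← Path.symm_symm t]
    rfl
  erw [key]
  rfl

/-- Extend a family of paths from `c 0` to `c 1, …, c n` by the constant path at `c 0`. -/
def pathsWithConst {n : ℕ} {c : Fin (n + 1) → Y} (t : ∀ i : Fin n, Path (c 0) (c i.succ)) :
    ∀ i : Fin (n + 1), Path (c 0) (c i) :=
  Fin.cases (Path.refl (c 0)) t

end LoopGroups

section Relators

open Monoid.Coprod

variable {n : ℕ} (G H : Type*) [Group G] [Group H]

/-- The free product `G * H * F(t₁, …, tₙ)`. -/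
abbrev VKProduct (n : ℕ) : Type _ := Monoid.Coprod (Monoid.Coprod G H) (FreeGroup (Fin n))

/-- The elements `t₀ = 1, t₁, …, tₙ` of `G * H * F(t₁, …, tₙ)`. -/
def VKProduct.t : Fin (n + 1) → VKProduct G H n :=
  Fin.cases 1 (fun i => inr (FreeGroup.of i))

variable {G H}

/-- The words `j_i^A(σ) (t_i j_i^B(σ) t_i⁻¹)⁻¹` for `0 ≤ i ≤ n` and `σ ∈ P i`. -/
def VKProduct.relators {P : Fin (n + 1) → Type*} [∀ i, Group (P i)]
    (jA : ∀ i, P i →* G) (jB : ∀ i, P i →* H) : Set (VKProduct G H n) :=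
  {w | ∃ (i : Fin (n + 1)) (σ : P i),
    w = inl (inl (jA i σ)) * (t G H i * inl (inr (jB i σ)) * (t G H i)⁻¹)⁻¹}

end Relators

/-! The subpolyhedra `A` and `B` need not be open, so instead of thickening them the argument glues
functors on the fundamental groupoid. A `PathHom` is such a functor to a group `Q`. Near each point
`z`, straight segments to `z` contract a small neighbourhood while keeping every point inside each
of the sets `A`, `B` that contains it (`Polyhedron.isLocallyConical`). This replaces openness of the
cover.

Suppose functors on `A` and `B` agree on paths in `A ∩ B`. Their values on the rays to `z` form
local potentials, and the quotients of two such potentials are locally constant. They are therefore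
the transition functions of a covering space with fiber `Q`, and its holonomy is a common extension
to `X` (`exists_pathHom_of_local`, `IsLocallyConical.exists_pathHom`). Conversely, a functor is
determined by its values on rays (`IsLocallyConical.pathHom_eq`).

To extend homomorphisms from the fundamental groups of `A` and `B`, turn them into functors by
joining the base point to each point of `C i` along `t_i` followed by a path in `C i`. On `C i` the
two functors then differ by conjugation with the image of `t_i`. Changing one of them by this
coboundary makes them agree, and this is exactly what the relators permit. So the fundamental group
of `X` has the universal property of the quotient (`LoopGroup.exists_hom_of_union`,
`LoopGroup.hom_ext_of_union`), and the two groups are isomorphic. -/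

section Gluing

/-! ### Functors from the fundamental groupoid to a group -/

open unitInterval Topology Bundle

/-- A homotopy invariant, multiplicative function on the paths of a space, with values in a group;
equivalently, a functor from the fundamental groupoid to the group. -/
structure PathHom (Y : Type*) [TopologicalSpace Y] (Q : Type*) [Group Q] where
  toFun : ∀ {x y : Y}, Path x y → Q
  map_homotopic' : ∀ {x y : Y} {p q : Path x y}, p.Homotopic q → toFun p = toFun q
  map_trans' : ∀ {x y z : Y} (p : Path x y) (q : Path y z),
    toFun (p.trans q) = toFun p * toFun q

namespace PathHom

variable {X Y Q R : Type*} [TopologicalSpace X] [TopologicalSpace Y] [Group Q] [Group R]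

instance : CoeFun (PathHom Y Q) fun _ => ∀ {x y : Y}, Path x y → Q := ⟨PathHom.toFun⟩

theorem map_homotopic (F : PathHom Y Q) {x y : Y} {p q : Path x y} (h : p.Homotopic q) :
    F p = F q := F.map_homotopic' h

theorem map_trans (F : PathHom Y Q) {x y z : Y} (p : Path x y) (q : Path y z) :
    F (p.trans q) = F p * F q := F.map_trans' p q

@[simp]
theorem map_refl (F : PathHom Y Q) (x : Y) : F (Path.refl x) = 1 := by
  have h := F.map_trans (Path.refl x) (Path.refl x)
  rw [Path.refl_trans_refl] at h
  exact left_eq_mul.mp h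

@[simp]
theorem map_symm (F : PathHom Y Q) {x y : Y} (p : Path x y) : F p.symm = (F p)⁻¹ := by
  rw [eq_inv_iff_mul_eq_one, ← F.map_trans, ← F.map_refl y]
  exact F.map_homotopic ⟨(Path.Homotopy.reflSymmTrans p).symm⟩

@[simp]
theorem map_cast (F : PathHom Y Q) {x y x' y' : Y} (p : Path x y) (hx : x' = x) (hy : y' = y) :
    F (p.cast hx hy) = F p := by
  subst hx hy; rfl

/-- The endpoints agree only propositionally, so the two paths cannot be compared by an equation
between them. -/
theorem congr_of_forall_eq (F : PathHom Y Q) {x y x' y' : Y} (p : Path x y) (q : Path x' y')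
    (h : ∀ t, p t = q t) : F p = F q := by
  obtain rfl : x = x' := by simpa using h 0
  obtain rfl : y = y' := by simpa using h 1
  exact congrArg _ (Path.ext (funext h))

/-- Pull back along a continuous map. -/
def comap (F : PathHom Y Q) {f : X → Y} (hf : Continuous f) : PathHom X Q where
  toFun p := F (p.map hf)
  map_homotopic' h := F.map_homotopic (h.map ⟨f, hf⟩)
  map_trans' p q := by rw [Path.map_trans, F.map_trans]

@[simp]
theorem comap_apply (F : PathHom Y Q) {f : X → Y} (hf : Continuous f) {x y : X} (p : Path x y) :
    F.comap hf p = F (p.map hf) := rfl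

/-- Compose with a group homomorphism. -/
def comp (F : PathHom Y Q) (φ : Q →* R) : PathHom Y R where
  toFun p := φ (F p)
  map_homotopic' h := by rw [F.map_homotopic h]
  map_trans' p q := by rw [F.map_trans, φ.map_mul]

@[simp]
theorem comp_apply (F : PathHom Y Q) (φ : Q →* R) {x y : Y} (p : Path x y) :
    F.comp φ p = φ (F p) := rfl

/-- Change by the coboundary of a function on the points. -/
def gauge (F : PathHom Y Q) (τ : Y → Q) : PathHom Y Q where
  toFun {x y} p := τ x * F p * (τ y)⁻¹
  map_homotopic' h := by rw [F.map_homotopic h]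
  map_trans' p q := by rw [F.map_trans]; group

@[simp]
theorem gauge_apply (F : PathHom Y Q) (τ : Y → Q) {x y : Y} (p : Path x y) :
    F.gauge τ p = τ x * F p * (τ y)⁻¹ := rfl

theorem map_subpath_mul (F : PathHom Y Q) {x y : Y} (p : Path x y) (r s t : I) :
    F (p.subpath r s) * F (p.subpath s t) = F (p.subpath r t) := by
  rw [← F.map_trans]
  exact F.map_homotopic ⟨Path.Homotopy.subpathTransSubpath p r s t⟩

/-- The values on the four sides of a square. -/
theorem map_square (F : PathHom Y Q) (S : C(I × I, Y)) {a b c d : Y} (l : Path a b) (r : Path c d)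
    (u : Path a c) (v : Path b d) (hl : ∀ t, l t = S (t, 0)) (hr : ∀ t, r t = S (t, 1))
    (hu : ∀ t, u t = S (0, t)) (hv : ∀ t, v t = S (1, t)) : F l * F v = F u * F r := by
  let e : Path (0 : I) 1 := ⟨⟨id, continuous_id⟩, rfl, rfl⟩
  -- The square is contractible, so the two ways around its boundary are homotopic.
  have key : ((e.prod (Path.refl (0 : I))).trans ((Path.refl (1 : I)).prod e)).Homotopic
      (((Path.refl (0 : I)).prod e).trans (e.prod (Path.refl (1 : I)))) := by
    have : ContractibleSpace I := (convex_Icc (0 : ℝ) 1).contractibleSpace ⟨0, by simp⟩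
    exact SimplyConnectedSpace.paths_homotopic _ _
  have h := (F.comap S.continuous).map_homotopic key
  rw [map_trans, map_trans] at h
  simp only [comap_apply] at h
  rw [F.congr_of_forall_eq l ((e.prod (Path.refl (0 : I))).map S.continuous) hl,
    F.congr_of_forall_eq v (((Path.refl (1 : I)).prod e).map S.continuous) hv,
    F.congr_of_forall_eq r ((e.prod (Path.refl (1 : I))).map S.continuous) hr,
    F.congr_of_forall_eq u (((Path.refl (0 : I)).prod e).map S.continuous) hu]
  exact h

/-- Two path homomorphisms agree on the paths from a point if they agree locally on the path
component of the point. -/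
theorem eq_of_locally_eq (F G : PathHom Y Q) {x₀ : Y}
    (h : ∀ z, Joined x₀ z → ∃ W ∈ 𝓝 z, ∀ {y : Y} (p : Path z y), (∀ t, p t ∈ W) → F p = G p)
    {x : Y} (p : Path x₀ x) : F p = G p := by
  -- Moving `t` to a nearby `s` multiplies both values on the right by the value on a short path
  -- from `p t`, where `F` and `G` agree; the quotient does not change.
  have hloc : IsLocallyConstant fun t : I => F (p.subpath 0 t) * (G (p.subpath 0 t))⁻¹ := by
    rw [IsLocallyConstant.iff_eventually_eq]
    intro t
    obtain ⟨W, hW, hFG⟩ := h (p t) ⟨(p.subpath 0 t).cast (by simp) rfl⟩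
    obtain ⟨V, hV, hVW⟩ : ∃ V ∈ 𝓝 t, ∀ s ∈ V, ∀ r, p.subpath t s r ∈ W := by
      have hc : Continuous fun a : I × I => p.subpath t a.1 a.2 :=
        p.subpath_continuous_family.comp (continuous_const.prodMk continuous_id)
      have : ∀ᶠ s in 𝓝 t, ∀ r ∈ (univ : Set I), p.subpath t s r ∈ W := by
        refine isCompact_univ.eventually_forall_of_forall_eventually fun r _ => ?_
        exact hc.continuousAt.eventually (by simpa using hW)
      exact ⟨_, this, fun s hs r => hs r (mem_univ r)⟩
    filter_upwards [hV] with s hs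
    rw [← F.map_subpath_mul p 0 t s, ← G.map_subpath_mul p 0 t s, hFG _ (hVW s hs)]
    group
  have h1 := hloc.apply_eq_of_preconnectedSpace 0 1
  simp only [Path.subpath_self, map_refl, Path.subpath_zero_one, map_cast] at h1
  simp only [mul_one, inv_one] at h1
  exact mul_inv_eq_one.mp h1.symm

end PathHom

/-! ### Holonomy of a covering space built from local potentials -/

section LocalTrivializations

variable {X Q : Type*} [TopologicalSpace X] [Group Q]

/-- The fiber bundle with discrete fiber `Q` whose transition functions are right multiplications
by `(g i x)⁻¹ * g j x`. -/
def principalBundleCore [TopologicalSpace Q] [DiscreteTopology Q] {U : X → Set X} (hU : ∀ z, IsOpen (U z))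
    (hmem : ∀ z, z ∈ U z) (g : X → X → Q)
    (hloc : ∀ i j, ∀ x ∈ U i ∩ U j, ∀ᶠ y in 𝓝 x, (g i y)⁻¹ * g j y = (g i x)⁻¹ * g j x) :
    FiberBundleCore X X Q where
  baseSet := U
  isOpen_baseSet := hU
  indexAt := id
  mem_baseSet_at := hmem
  coordChange i j x q := q * ((g i x)⁻¹ * g j x)
  coordChange_self i x _ q := by group
  continuousOn_coordChange i j := by
    refine continuousOn_of_forall_continuousAt fun a ha => ?_
    have h1 : ∀ᶠ b : X × Q in 𝓝 a, b.2 * ((g i b.1)⁻¹ * g j b.1) =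
        b.2 * ((g i a.1)⁻¹ * g j a.1) :=
      (continuous_fst.continuousAt.eventually (hloc i j a.1 ha.1)).mono fun b hb => by rw [hb]
    have h2 : Continuous fun b : X × Q => b.2 * ((g i a.1)⁻¹ * g j a.1) :=
      (continuous_of_discreteTopology (f := fun q : Q => q * ((g i a.1)⁻¹ * g j a.1))).comp
        continuous_snd
    exact h2.continuousAt.congr (h1.mono fun b hb => hb.symm)
  coordChange_comp i j k x _ q := by group

/-- A family of local coboundaries whose quotients are locally constant is induced by a path
homomorphism, the holonomy of the corresponding bundle. -/
theorem exists_pathHom_of_local {U : X → Set X} (hU : ∀ z, IsOpen (U z)) (hmem : ∀ z, z ∈ U z)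
    (g : X → X → Q)
    (hloc : ∀ i j, ∀ x ∈ U i ∩ U j, ∀ᶠ y in 𝓝 x, (g i y)⁻¹ * g j y = (g i x)⁻¹ * g j x)
    (hone : ∀ z, g z z = 1) :
    ∃ F : PathHom X Q, ∀ (z : X) {x y : X} (p : Path x y), (∀ t, p t ∈ U z) →
      F p = g z x * (g z y)⁻¹ := by
  let _ : TopologicalSpace Q := ⊥
  have : DiscreteTopology Q := ⟨rfl⟩
  let Z := principalBundleCore hU hmem g hloc
  have cov : IsCoveringMap (π Q Z.Fiber) := FiberBundle.isCoveringMap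
  let val : TotalSpace Q Z.Fiber → Q := fun v => v.2
  -- Left multiplications commute with the transition functions, which multiply on the right. So
  -- they act on the total space and carry lifts to lifts; this makes holonomy multiplicative.
  let L : Q → TotalSpace Q Z.Fiber → TotalSpace Q Z.Fiber := fun a v => ⟨v.1, a * val v⟩
  have hL : ∀ a, Continuous (L a) := by
    intro a
    refine continuous_iff_continuousAt.2 fun v => ?_
    rw [FiberBundle.continuousAt_totalSpace]
    refine ⟨(FiberBundle.continuous_proj Q Z.Fiber).continuousAt, ?_⟩
    have h1 := ((FiberBundle.continuousAt_totalSpace Q (id : TotalSpace Q Z.Fiber → _)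
      (x₀ := v)).1 continuousAt_id).2
    have h2 : Continuous fun q : Q => a * q := continuous_of_discreteTopology
    refine (h2.continuousAt.comp h1).congr (Filter.Eventually.of_forall fun w => ?_)
    exact (mul_assoc a _ _).symm
  let lift {x y : X} (p : Path x y) : C(I, TotalSpace Q Z.Fiber) :=
    cov.liftPath p ⟨x, (1 : Q)⟩ p.source
  have lift_proj : ∀ {x y : X} (p : Path x y) (t : I), (lift p t).1 = p t :=
    fun p t => congrFun (cov.liftPath_lifts _ _ p.source) t
  have lift_mul : ∀ {x y : X} (p : Path x y) (v : TotalSpace Q Z.Fiber) (hv : (p : C(I, X)) 0 = v.1),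
      val (cov.liftPath p v hv 1) = val v * val (lift p 1) := by
    intro x y p v hv
    have h0 : lift p 0 = ⟨x, (1 : Q)⟩ := cov.liftPath_zero _ _ p.source
    obtain ⟨v, q⟩ := v
    obtain rfl : x = v := p.source.symm.trans hv
    have := congrFun ((cov.eq_liftPath_iff hv (Γ := L q ∘ lift p)).2
      ⟨(hL q).comp (lift p).continuous, funext fun s => lift_proj p s, by
        rw [Function.comp_apply, h0]; exact congrArg (TotalSpace.mk x) (mul_one (M := Q) q)⟩) 1
    exact (congrArg val this).symm
  refine ⟨⟨fun p => val (lift p 1), ?_, ?_⟩, ?_⟩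
  · intro x y p q h
    exact congrArg val (cov.liftPath_apply_one_eq_of_homotopicRel h _ p.source q.source)
  · intro x y z p q
    rw [← lift_mul q (lift p 1) (by rw [lift_proj, p.target]; exact q.source)]
    have := congrArg (fun f : C(I, _) => f 1) (cov.liftPath_trans (e := ⟨x, (1 : Q)⟩) rfl p q)
    exact congrArg val (this.trans (Path.target _))
  · intro z x y p hp
    have hx : x ∈ U z := by simpa using hp 0
    -- The section with constant coordinate `g z x` in the chart at `z` lifts `p`. By `hone`, in the
    -- charts at the points of `p` themselves it starts at `1` and ends at `g z x * (g z y)⁻¹`.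
    have hc : Continuous fun t : I => (Z.localTriv z).toOpenPartialHomeomorph.symm (p t, g z x) := by
      refine (Z.localTriv z).toOpenPartialHomeomorph.continuousOn_symm.comp_continuous
        (p.continuous.prodMk continuous_const) fun t => ?_
      exact (Z.mem_localTriv_target z _).2 (hp t)
    have h0 : (Z.localTriv z).toOpenPartialHomeomorph.symm (p 0, g z x) = ⟨x, (1 : Q)⟩ := by
      rw [p.source, Z.localTriv_symm_apply]
      refine congrArg (TotalSpace.mk x) ?_
      change g z x * ((g z x)⁻¹ * g x x) = 1
      rw [hone, mul_one, mul_inv_cancel]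
    have h1 := congrFun ((cov.eq_liftPath_iff (γ := p) (e := ⟨x, (1 : Q)⟩) p.source).2 ⟨hc, rfl, h0⟩) 1
    refine (congrArg val h1).symm.trans ?_
    change g z x * ((g z (p 1))⁻¹ * g (p 1) (p 1)) = _
    rw [hone, mul_one, p.target]

end LocalTrivializations

/-! ### Gluing along locally conical covers -/

section Conical

variable {X : Type*} [TopologicalSpace X] {ι : Type*}

/-- The corestriction of a path to a subset. -/
def Path.codRestrict {x y : X} (p : Path x y) {A : Set X} (h : ∀ t, p t ∈ A) :
    Path (⟨x, p.source ▸ h 0⟩ : A) ⟨y, p.target ▸ h 1⟩ where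
  toFun t := ⟨p t, h t⟩
  continuous_toFun := p.continuous.subtype_mk h
  source' := Subtype.ext p.source
  target' := Subtype.ext p.target

/-- An open neighbourhood of `z` with a contraction to `z` inside `X` that fixes `z` and
preserves each of the sets `A i`. -/
structure ConicalNhd (A : ι → Set X) (z : X) where
  carrier : Set X
  isOpen_carrier : IsOpen carrier
  mem_carrier : z ∈ carrier
  contr : C(carrier × I, X)
  contr_zero : ∀ x, contr (x, 0) = x
  contr_one : ∀ x, contr (x, 1) = z
  contr_center : ∀ t, contr (⟨z, mem_carrier⟩, t) = z
  contr_mem : ∀ i (x : carrier) t, (x : X) ∈ A i → contr (x, t) ∈ A i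

/-- Every point has arbitrarily small conical neighbourhoods with respect to the sets `A i`. -/
def IsLocallyConical (A : ι → Set X) : Prop :=
  ∀ z, ∀ O ∈ 𝓝 z, ∃ N : ConicalNhd A z, ∀ x t, N.contr (x, t) ∈ O

namespace ConicalNhd

variable {A : ι → Set X} {z : X} (N : ConicalNhd A z)

/-- The path from a point to the center. -/
def ray {x : X} (hx : x ∈ N.carrier) : Path x z where
  toFun t := N.contr (⟨x, hx⟩, t)
  continuous_toFun := N.contr.continuous.comp (Continuous.prodMk_right _)
  source' := N.contr_zero _
  target' := N.contr_one _

theorem ray_mem {x : X} (hx : x ∈ N.carrier) {i : ι} (hi : x ∈ A i) (t : I) : N.ray hx t ∈ A i :=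
  N.contr_mem i _ t hi

theorem ray_center : N.ray N.mem_carrier = Path.refl z := Path.ext (funext N.contr_center)

theorem center_mem {x : X} (hx : x ∈ N.carrier) {i : ι} (hi : x ∈ A i) : z ∈ A i := by
  simpa using N.ray_mem hx hi 1

/-- Contracting the path to `z` sweeps out a square inside `A i`, whose sides are the path, the two
rays and a constant path. -/
theorem map_mul_map_ray {Q : Type*} [Group Q] {i : ι} (F : PathHom (A i) Q) {x y : X}
    (p : Path x y) (hp : ∀ t, p t ∈ A i) (hx : x ∈ N.carrier) (hy : y ∈ N.carrier)
    (hpN : ∀ t, p t ∈ N.carrier) (hxi : x ∈ A i) (hyi : y ∈ A i) :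
    F (p.codRestrict hp) * F ((N.ray hy).codRestrict (N.ray_mem hy hyi)) =
      F ((N.ray hx).codRestrict (N.ray_mem hx hxi)) := by
  have hS : Continuous fun a : I × I => (⟨N.contr (⟨p a.1, hpN a.1⟩, a.2),
      N.contr_mem i _ _ (hp a.1)⟩ : A i) :=
    (N.contr.continuous.comp ((((p.continuous.comp continuous_fst).subtype_mk _).prodMk
      continuous_snd))).subtype_mk _
  have h := F.map_square ⟨_, hS⟩ (p.codRestrict hp)
    (Path.refl (⟨z, N.center_mem hx hxi⟩ : A i))
    ((N.ray hx).codRestrict (N.ray_mem hx hxi)) ((N.ray hy).codRestrict (N.ray_mem hy hyi))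
    (fun t => Subtype.ext (N.contr_zero ⟨p t, hpN t⟩).symm) (fun t => Subtype.ext (N.contr_one _).symm)
    (fun t => Subtype.ext <| congrArg (fun b => N.contr (b, t)) (Subtype.ext p.source.symm))
    (fun t => Subtype.ext <| congrArg (fun b => N.contr (b, t)) (Subtype.ext p.target.symm))
  rwa [F.map_refl, mul_one] at h

end ConicalNhd

/-- Compatible path homomorphisms on the members of a cover, for which the space is locally
conical, have a common extension. -/
theorem IsLocallyConical.exists_pathHom {A : ι → Set X} (hA : IsLocallyConical A)
    (hcov : ∀ x, ∃ i, x ∈ A i) {Q : Type*} [Group Q] (F : ∀ i, PathHom (A i) Q)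
    (hF : ∀ i j {x y : X} (p : Path x y) (hi : ∀ t, p t ∈ A i) (hj : ∀ t, p t ∈ A j),
      F i (p.codRestrict hi) = F j (p.codRestrict hj)) :
    ∃ G : PathHom X Q, ∀ i {x y : A i} (p : Path x y), G (p.map continuous_subtype_val) = F i p := by
  classical
  choose N _ using fun z => hA z univ Filter.univ_mem
  choose k hk using hcov
  -- The potential of `x` is the value on its ray to `z`. The ray stays in every member that
  -- contains `x`, so by compatibility the choice of `k x` is immaterial.
  let g : X → X → Q := fun z x =>
    if hx : x ∈ (N z).carrier then F (k x) (((N z).ray hx).codRestrict ((N z).ray_mem hx (hk x)))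
    else 1
  have g_eq : ∀ z {x : X} (hx : x ∈ (N z).carrier) {i : ι} (hi : x ∈ A i),
      g z x = F i (((N z).ray hx).codRestrict ((N z).ray_mem hx hi)) := by
    intro z x hx i hi
    simp only [g, dif_pos hx]
    exact hF _ _ _ _ _
  have F_eq : ∀ z i {x y : X} (p : Path x y) (hp : ∀ t, p t ∈ A i)
      (hpN : ∀ t, p t ∈ (N z).carrier), F i (p.codRestrict hp) = g z x * (g z y)⁻¹ := by
    intro z i x y p hp hpN
    have hx : x ∈ (N z).carrier := by simpa using hpN 0
    have hy : y ∈ (N z).carrier := by simpa using hpN 1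
    have hxi : x ∈ A i := by simpa using hp 0
    have hyi : y ∈ A i := by simpa using hp 1
    rw [g_eq z hx hxi, g_eq z hy hyi, eq_mul_inv_iff_mul_eq]
    exact (N z).map_mul_map_ray (F i) p hp hx hy hpN hxi hyi
  obtain ⟨G, hG⟩ := exists_pathHom_of_local (fun z => (N z).isOpen_carrier)
    (fun z => (N z).mem_carrier) g (by
      intro i j x hx
      -- The rays of a small conical neighbourhood of `x` lie in both carriers, so both potentials
      -- change by the same amount from `y` to `x`.
      obtain ⟨M, hM⟩ := hA x _ (((N i).isOpen_carrier.inter (N j).isOpen_carrier).mem_nhds hx)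
      filter_upwards [M.isOpen_carrier.mem_nhds M.mem_carrier] with y hy
      have h1 := F_eq i (k y) (M.ray hy) (M.ray_mem hy (hk y)) fun t => (hM _ t).1
      have h2 := F_eq j (k y) (M.ray hy) (M.ray_mem hy (hk y)) fun t => (hM _ t).2
      rw [h1] at h2
      have h4 : g i y = g j y * (g j x)⁻¹ * g i x := by rw [← h2]; group
      rw [h4]; group) (by
      intro z
      rw [g_eq z (N z).mem_carrier (hk z)]
      rw [← (F (k z)).map_refl ⟨z, hk z⟩]
      exact (F (k z)).congr_of_forall_eq _ _ fun t => Subtype.ext ((N z).contr_center t))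
  refine ⟨G, fun i x y p => ?_⟩
  refine PathHom.eq_of_locally_eq (G.comap continuous_subtype_val) (F i) (fun z _ => ?_) p
  refine ⟨_, continuous_subtype_val.continuousAt.preimage_mem_nhds
    ((N (z : X)).isOpen_carrier.mem_nhds (N (z : X)).mem_carrier), fun q hq => ?_⟩
  rw [PathHom.comap_apply, hG z _ hq]
  exact (F_eq z i (q.map continuous_subtype_val) (fun t => (q t).2) hq).symm

/-- Two path homomorphisms agree on the paths from a point if they agree on those paths in the
members of a locally conical cover that lie in the path component of the point. -/
theorem IsLocallyConical.pathHom_eq {A : ι → Set X} (hA : IsLocallyConical A)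
    (hcov : ∀ x, ∃ i, x ∈ A i) {Q : Type*} [Group Q] (F G : PathHom X Q) {x₀ : X}
    (hFG : ∀ i {x y : A i} (p : Path x y), Joined x₀ (x : X) →
      F (p.map continuous_subtype_val) = G (p.map continuous_subtype_val))
    {x : X} (p : Path x₀ x) : F p = G p := by
  refine PathHom.eq_of_locally_eq F G (fun z hz => ?_) p
  obtain ⟨N, -⟩ := hA z univ Filter.univ_mem
  refine ⟨_, N.isOpen_carrier.mem_nhds N.mem_carrier, fun {y} q hq => ?_⟩
  have hy : y ∈ N.carrier := by simpa using hq 1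
  have ray_eq : F (N.ray hy) = G (N.ray hy) := by
    obtain ⟨i, hi⟩ := hcov y
    exact hFG i ((N.ray hy).codRestrict (N.ray_mem hy hi)) (hz.trans ⟨q⟩)
  -- The path `q` may wander between the members of the cover, but the ray from its endpoint stays
  -- in one of them and determines the value on `q`.
  have key : ∀ H : PathHom X Q, H q = (H (N.ray hy))⁻¹ := by
    intro H
    have hS : Continuous fun a : I × I => N.contr (⟨q a.1, hq a.1⟩, a.2) :=
      N.contr.continuous.comp (((q.continuous.comp continuous_fst).subtype_mk _).prodMk
        continuous_snd)
    have h := H.map_square ⟨_, hS⟩ q (Path.refl z) (N.ray N.mem_carrier) (N.ray hy)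
      (fun t => (N.contr_zero ⟨q t, hq t⟩).symm) (fun t => (N.contr_one _).symm)
      (fun t => congrArg (fun b => N.contr (b, t)) (Subtype.ext q.source.symm))
      (fun t => congrArg (fun b => N.contr (b, t)) (Subtype.ext q.target.symm))
    rwa [N.ray_center, H.map_refl, mul_one, ← eq_inv_iff_mul_eq_one] at h
  rw [key F, key G, ray_eq]

/-- Let a point lie in all members of a locally conical cover, and suppose that each member
contains a path to it from each of its points that lies in another member. Then each member contains
a path to it from each of its points in the path component. -/
theorem IsLocallyConical.joined {A : ι → Set X} (hA : IsLocallyConical A)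
    (hcov : ∀ x, ∃ i, x ∈ A i) {x₀ : X} (h₀ : ∀ i, x₀ ∈ A i)
    (hjoin : ∀ i j, i ≠ j → ∀ x ∈ A i ∩ A j, JoinedIn (A i) x₀ x) {x : X} (hx : Joined x₀ x)
    {i : ι} (hi : x ∈ A i) : JoinedIn (A i) x₀ x := by
  let P : X → Prop := fun x => ∃ i, JoinedIn (A i) x₀ x
  have all : ∀ {x}, P x → ∀ j, x ∈ A j → JoinedIn (A j) x₀ x := by
    rintro x ⟨i, hi⟩ j hj
    by_cases hij : i = j
    · exact hij ▸ hi
    · exact hjoin j i (Ne.symm hij) x ⟨hj, hi.target_mem⟩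
  have hP : IsLocallyConstant P := by
    rw [IsLocallyConstant.iff_eventually_eq]
    intro z
    obtain ⟨N, -⟩ := hA z univ Filter.univ_mem
    filter_upwards [N.isOpen_carrier.mem_nhds N.mem_carrier] with y hy
    obtain ⟨k, hk⟩ := hcov y
    have hyz : JoinedIn (A k) y z := ⟨N.ray hy, N.ray_mem hy hk⟩
    exact propext ⟨fun h => ⟨k, (all h k hk).trans hyz⟩,
      fun h => ⟨k, (all h k hyz.target_mem).trans hyz.symm⟩⟩
  obtain ⟨p⟩ := hx
  have h := (hP.comp_continuous p.continuous).apply_eq_of_preconnectedSpace 0 1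
  simp only [Function.comp_apply, p.source, p.target] at h
  exact all (h ▸ ⟨i, JoinedIn.refl (h₀ i)⟩) i hi

end Conical

theorem IsLocallyConical.of_homeomorph {X Y ι : Type*} [TopologicalSpace X] [TopologicalSpace Y]
    (h : Y ≃ₜ X) {A : ι → Set X} (hA : IsLocallyConical fun i => h ⁻¹' A i) :
    IsLocallyConical A := by
  intro z O hO
  obtain ⟨N, hN⟩ := hA (h.symm z) (h ⁻¹' O)
    (h.continuous.continuousAt.preimage_mem_nhds (by simpa using hO))
  let e : C(h.symm ⁻¹' N.carrier, N.carrier) :=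
    ⟨fun x => ⟨h.symm x, x.2⟩, (h.symm.continuous.comp continuous_subtype_val).subtype_mk _⟩
  refine ⟨⟨h.symm ⁻¹' N.carrier, N.isOpen_carrier.preimage h.symm.continuous, N.mem_carrier,
    ⟨fun a => h (N.contr (e a.1, a.2)), h.continuous.comp (N.contr.continuous.comp
      ((e.continuous.comp continuous_fst).prodMk continuous_snd))⟩, fun x => ?_, fun x => ?_,
    fun t => ?_, fun i x t hx => ?_⟩, fun x t => hN _ t⟩
  · simp [N.contr_zero, e]
  · simp [N.contr_one]
  · have := N.contr_center t
    simp [e, this]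
  · refine N.contr_mem i _ t ?_
    simpa [e] using hx

/-! ### Polyhedra are locally conical -/

namespace Polyhedron

open Geometry

variable {E : Type*} [AddCommGroup E] [Module ℝ E] {K : SimplicialComplex ℝ E}

theorem isOpen_iff {U : Set (Polyhedron K)} :
    IsOpen U ↔ ∀ s : K.faces, IsOpen (simplexMap K s ⁻¹' U) := by
  simp only [isOpen_iSup_iff, isOpen_coinduced]

theorem isClosed_iff {U : Set (Polyhedron K)} :
    IsClosed U ↔ ∀ s : K.faces, IsClosed (simplexMap K s ⁻¹' U) := by
  simp only [← isOpen_compl_iff, isOpen_iff, preimage_compl]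

theorem continuous_simplexMap (s : K.faces) : Continuous (simplexMap K s) :=
  continuous_def.2 fun _ hU => isOpen_iff.1 hU s

/-- A map on an open subset is continuous if it is continuous on every simplex. -/
theorem continuous_of_simplexMap {W : Set (Polyhedron K)} (hW : IsOpen W) {Y : Type*}
    [TopologicalSpace Y] (f : W → Y)
    (hf : ∀ s : K.faces, Continuous fun w : simplexMap K s ⁻¹' W => f ⟨simplexMap K s w, w.2⟩) :
    Continuous f := by
  refine continuous_def.2 fun V hV => ?_
  have h : IsOpen (Subtype.val '' (f ⁻¹' V)) := by
    refine isOpen_iff.2 fun s => ?_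
    have h1 := (isOpen_iff.1 hW s).isOpenMap_subtype_val _ (hV.preimage (hf s))
    convert h1 using 1
    ext w
    constructor
    · rintro ⟨x, hx, hxw⟩
      obtain ⟨x, hxW⟩ := x
      obtain rfl : x = simplexMap K s w := hxw
      exact ⟨⟨w, hxW⟩, hx, rfl⟩
    · rintro ⟨w, hw, rfl⟩
      exact ⟨_, hw, rfl⟩
  exact preimage_image_eq (f ⁻¹' V) Subtype.val_injective ▸ h.preimage continuous_subtype_val

theorem coe_simplexMap (s : K.faces) (w : stdSimplex ℝ (s : Finset E)) :
    (simplexMap K s w).1 = Fintype.linearCombination ℝ (fun v : (s : Finset E) => (v : E)) w.1 := by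
  rw [Fintype.linearCombination_apply]; rfl

theorem simplexMap_mem (s : K.faces) (w : stdSimplex ℝ (s : Finset E)) :
    (simplexMap K s w).1 ∈ convexHull ℝ ((s : Finset E) : Set E) :=
  (convex_convexHull ℝ _).sum_mem (fun v _ => w.2.1 v) w.2.2 fun v _ => subset_convexHull ℝ _ v.2

theorem exists_coe_simplexMap_eq (s : K.faces) {x : E}
    (hx : x ∈ convexHull ℝ ((s : Finset E) : Set E)) : ∃ w, (simplexMap K s w).1 = x := by
  rw [Finset.mem_convexHull'] at hx
  obtain ⟨w, h0, h1, h2⟩ := hx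
  refine ⟨⟨fun v => w v, fun v => h0 v v.2, ?_⟩, ?_⟩
  · rw [Finset.sum_coe_sort _ w, h1]
  · exact (Finset.sum_coe_sort _ fun v => w v • v).trans h2

theorem simplexMap_injective (s : K.faces) : Function.Injective (simplexMap K s) := by
  intro w w' h
  have h' : ∑ v : (s : Finset E), w.1 v • (v : E) = ∑ v : (s : Finset E), w'.1 v • (v : E) :=
    congrArg Subtype.val h
  have key := affineIndependent_iff.1 (K.indep s.2) Finset.univ (fun v => w.1 v - w'.1 v)
    (by rw [Finset.sum_sub_distrib, w.2.2, w'.2.2, sub_self])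
    (by simp only [sub_smul, Finset.sum_sub_distrib]; exact sub_eq_zero.2 h')
  exact Subtype.ext (funext fun v => sub_eq_zero.1 (key v (Finset.mem_univ v)))

/-- Since `E` has no topology, closedness is checked in barycentric coordinates: by injectivity of
the characteristic map, the preimage is the convex hull of finitely many points, hence compact. -/
theorem isClosed_preimage_convexHull (s : K.faces) (u : Finset E)
    (hu : convexHull ℝ (u : Set E) ⊆ convexHull ℝ ((s : Finset E) : Set E)) :
    IsClosed {w | (simplexMap K s w).1 ∈ convexHull ℝ (u : Set E)} := by
  choose f hf using fun v : u => exists_coe_simplexMap_eq s (hu (subset_convexHull ℝ _ v.2))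
  let T := Fintype.linearCombination ℝ (fun v : (s : Finset E) => (v : E))
  let D : Set (↥(s : Finset E) → ℝ) := range fun v => (f v).1
  have hT : T '' convexHull ℝ D = convexHull ℝ (u : Set E) := by
    rw [T.image_convexHull]
    congr 1
    ext x
    simp only [D, mem_image, mem_range, exists_exists_eq_and]
    constructor
    · rintro ⟨v, rfl⟩
      rw [← coe_simplexMap, hf]; exact v.2
    · exact fun hx => ⟨⟨x, hx⟩, by rw [← coe_simplexMap, hf]⟩
  have hD : convexHull ℝ D ⊆ stdSimplex ℝ (s : Finset E) :=
    convexHull_min (by rintro _ ⟨v, rfl⟩; exact (f v).2) (convex_stdSimplex ℝ _)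
  have : {w | (simplexMap K s w).1 ∈ convexHull ℝ (u : Set E)} = Subtype.val ⁻¹' convexHull ℝ D := by
    ext w
    rw [mem_ofPred_eq, mem_preimage, ← hT]
    constructor
    · rintro ⟨w', hw', h⟩
      have : (⟨w', hD hw'⟩ : stdSimplex ℝ (s : Finset E)) = w :=
        simplexMap_injective s (Subtype.ext ((coe_simplexMap s _).trans h))
      exact this ▸ hw'
    · exact fun h => ⟨w.1, h, (coe_simplexMap s w).symm⟩
  rw [this]
  exact ((finite_range _).isCompact_convexHull ℝ).isClosed.preimage continuous_subtype_val

/-- The union of a downward closed set of simplices of a subdivision is closed. -/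
theorem isClosed_of_isSubdivision {K' : SimplicialComplex ℝ E} (hK : IsSubdivision K' K)
    (S : Set (Finset E)) (hS : S ⊆ K'.faces)
    (hdown : ∀ t ∈ S, ∀ u ⊆ t, u.Nonempty → u ∈ S) :
    IsClosed {x : Polyhedron K | ∃ t ∈ S, x.1 ∈ convexHull ℝ (t : Set E)} := by
  classical
  refine isClosed_iff.2 fun s => ?_
  obtain ⟨F, hF, hsF⟩ := hK.2 s s.2
  have : simplexMap K s ⁻¹' {x : Polyhedron K | ∃ t ∈ S, x.1 ∈ convexHull ℝ (t : Set E)} =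
      ⋃ u ∈ (F.biUnion Finset.powerset).filter (· ∈ S),
        {w | (simplexMap K s w).1 ∈ convexHull ℝ (u : Set E)} := by
    ext w
    simp only [mem_preimage, mem_ofPred_eq, mem_iUnion, Finset.mem_filter, Finset.mem_biUnion,
      Finset.mem_powerset, exists_prop]
    constructor
    · rintro ⟨t, htS, ht⟩
      have hw := simplexMap_mem s w
      rw [hsF] at hw
      simp only [mem_iUnion, exists_prop] at hw
      obtain ⟨t', ht'F, ht'⟩ := hw
      -- Simplices of `K'` meet in common faces, so `S` enters the simplex `s` only through faces of
      -- the finitely many members of `F`.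
      have h := K'.inter_subset_convexHull (hS htS) (hF t' ht'F) ⟨ht, ht'⟩
      rw [← Finset.coe_inter] at h
      refine ⟨t ∩ t', ⟨⟨t', ht'F, Finset.inter_subset_right⟩, ?_⟩, h⟩
      exact hdown t htS _ Finset.inter_subset_left
        (Finset.coe_nonempty.1 (convexHull_nonempty_iff.1 ⟨_, h⟩))
    · rintro ⟨u, ⟨-, huS⟩, hu⟩
      exact ⟨u, huS, hu⟩
  rw [this]
  refine isClosed_biUnion_finset fun u hu => isClosed_preimage_convexHull s u ?_
  simp only [Finset.mem_filter, Finset.mem_biUnion, Finset.mem_powerset] at hu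
  obtain ⟨⟨t, htF, hut⟩, -⟩ := hu
  rw [hsF]
  exact (convexHull_mono (Finset.coe_subset.2 hut)).trans
    (subset_biUnion_of_mem (u := fun t : Finset E => convexHull ℝ (t : Set E)) htF)

/-- The open star of a point in a simplicial complex `K'`. -/
def openStar (K' : SimplicialComplex ℝ E) (z : Polyhedron K) : Set (Polyhedron K) :=
  {x | ∀ t ∈ K'.faces, x.1 ∈ convexHull ℝ (t : Set E) → z.1 ∈ convexHull ℝ (t : Set E)}

theorem mem_openStar (K' : SimplicialComplex ℝ E) (z : Polyhedron K) : z ∈ openStar K' z :=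
  fun _ _ h => h

/-- The complement is the union of the simplices that miss `z`, and these form a downward closed
set. -/
theorem isOpen_openStar {K' : SimplicialComplex ℝ E} (hK : IsSubdivision K' K)
    (z : Polyhedron K) : IsOpen (openStar K' z) := by
  have h := isClosed_of_isSubdivision hK {t ∈ K'.faces | z.1 ∉ convexHull ℝ (t : Set E)}
    (fun t ht => ht.1) fun t ht u hut hu => ⟨K'.down_closed ht.1 hut hu, fun hz =>
      ht.2 (convexHull_mono (Finset.coe_subset.2 hut) hz)⟩
  rw [← isClosed_compl_iff]
  convert h using 1
  ext x
  simp [openStar, and_assoc, and_comm]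

theorem isSubdivision_refl (K : SimplicialComplex ℝ E) : IsSubdivision K K :=
  ⟨fun t ht => ⟨t, ht, Subset.rfl⟩, fun s hs => ⟨{s}, by simpa using hs, by simp⟩⟩

/-- The point of the segment from a point `x` of the open star of `z` to `z`. -/
def segmentPoint (z : Polyhedron K) (x : openStar K z) (t : I) : Polyhedron K :=
  ⟨AffineMap.lineMap x.1.1 z.1 (t : ℝ), by
    obtain ⟨s, hs, hx⟩ := SimplicialComplex.mem_space_iff.1 x.1.2
    exact SimplicialComplex.convexHull_subset_space hs
      ((convex_convexHull ℝ _).lineMap_mem hx (x.2 s hs hx) t.2)⟩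

/-- A simplex that meets the open star of `z` contains `z`, so the contraction is a straight-line
homotopy in its barycentric coordinates. -/
theorem continuous_segmentPoint_simplexMap (z : Polyhedron K) (s : K.faces) :
    Continuous fun a : (simplexMap K s ⁻¹' openStar K z) × I =>
      segmentPoint z ⟨simplexMap K s a.1, a.1.2⟩ a.2 := by
  by_cases hz : z.1 ∈ convexHull ℝ ((s : Finset E) : Set E)
  · obtain ⟨w, hw⟩ := exists_coe_simplexMap_eq s hz
    have hc : Continuous fun a : (simplexMap K s ⁻¹' openStar K z) × I =>
        (⟨AffineMap.lineMap a.1.1.1 w.1 (a.2 : ℝ),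
          (convex_stdSimplex ℝ _).lineMap_mem a.1.1.2 w.2 a.2.2⟩ :
            stdSimplex ℝ (s : Finset E)) := by
      refine Continuous.subtype_mk ?_ _
      simp only [AffineMap.lineMap_apply_module]
      fun_prop
    convert (continuous_simplexMap s).comp hc using 1
    funext a
    refine Subtype.ext ?_
    rw [Function.comp_apply, coe_simplexMap]
    simp only [segmentPoint, AffineMap.lineMap_apply_module, map_add, map_smul, ← coe_simplexMap,
      hw]
  · have : IsEmpty (simplexMap K s ⁻¹' openStar K z) :=
      ⟨fun w => hz (w.2 s s.2 (simplexMap_mem s w.1))⟩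
    exact continuous_of_const fun a => (this.false a.1).elim

theorem continuous_segmentPoint_right (z : Polyhedron K) (x : openStar K z) :
    Continuous (segmentPoint z x) := by
  obtain ⟨x, hxz⟩ := x
  obtain ⟨s, hs, hx⟩ := SimplicialComplex.mem_space_iff.1 x.2
  generalize hs' : (⟨s, hs⟩ : K.faces) = s'
  obtain ⟨w, hw⟩ := exists_coe_simplexMap_eq s' (by subst hs'; exact hx)
  obtain rfl : simplexMap K s' w = x := Subtype.ext hw
  let w' : simplexMap K s' ⁻¹' openStar K z := ⟨w, hxz⟩
  have h := (continuous_segmentPoint_simplexMap z s').comp (Continuous.prodMk_right w')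
  exact h

/-- The weak topology tests continuity simplexwise on the open star, not directly on its product
with `I`. Currying moves `I` into the target, and local compactness of `I` allows uncurrying. -/
theorem continuous_segmentPoint (z : Polyhedron K) :
    Continuous fun a : openStar K z × I => segmentPoint z a.1 a.2 := by
  let f : openStar K z → C(I, Polyhedron K) :=
    fun x => ⟨segmentPoint z x, continuous_segmentPoint_right z x⟩
  have hf : Continuous f := continuous_of_simplexMap (isOpen_openStar (isSubdivision_refl K) z) f
    fun s => (ContinuousMap.curry ⟨_, continuous_segmentPoint_simplexMap z s⟩).continuous
  exact ContinuousMap.continuous_uncurry_of_continuous ⟨f, hf⟩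

/-- A polyhedron is locally conical with respect to finitely many subpolyhedra. -/
theorem isLocallyConical {ι : Type*} [Finite ι] (K' L : ι → SimplicialComplex ℝ E)
    (hK : ∀ i, IsSubdivision (K' i) K) (hL : ∀ i, (L i).faces ⊆ (K' i).faces) :
    IsLocallyConical fun i => {x : Polyhedron K | x.1 ∈ (L i).space} := by
  intro z O hO
  obtain ⟨O', hO'O, hO', hzO'⟩ := mem_nhds_iff.1 hO
  have hSt := isOpen_openStar (isSubdivision_refl K) z
  let V : Set (Polyhedron K) := O' ∩ ⋂ i, openStar (K' i) z
  have hV : IsOpen V := hO'.inter (isOpen_iInter_of_finite fun i => isOpen_openStar (hK i) z)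
  have hc := continuous_segmentPoint z
  -- The points whose whole segment to `z` stays in `V`; compactness of `I` makes this set open.
  let W : Set (openStar K z) := {x | ∀ t ∈ (univ : Set I), segmentPoint z x t ∈ V}
  have hW : IsOpen W := by
    refine isOpen_iff_mem_nhds.2 fun x hx => ?_
    refine isCompact_univ.eventually_forall_of_forall_eventually fun t ht => ?_
    exact hc.continuousAt.eventually (hV.mem_nhds (hx t ht))
  have h0 : ∀ x : openStar K z, segmentPoint z x 0 = x := fun x => Subtype.ext (by
    simp [segmentPoint])
  have hz : ∀ t, segmentPoint z ⟨z, mem_openStar K z⟩ t = z := fun t => Subtype.ext (by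
    simp [segmentPoint])
  let e : (Subtype.val '' W : Set (Polyhedron K)) → openStar K z := fun x =>
    ⟨x.1, by obtain ⟨y, -, hy⟩ := x.2; exact hy ▸ y.2⟩
  have he : ∀ x, e x ∈ W := by rintro ⟨_, ⟨y, hy, rfl⟩⟩; exact hy
  refine ⟨⟨Subtype.val '' W, hSt.isOpenMap_subtype_val _ hW,
    ⟨⟨z, mem_openStar K z⟩, fun t _ => ?_, rfl⟩, ⟨fun a => segmentPoint z (e a.1) a.2,
      hc.comp (((continuous_subtype_val.comp continuous_fst).subtype_mk _).prodMk continuous_snd)⟩,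
    fun x => h0 (e x), fun x => ?_, fun t => hz t, fun i x t hx => ?_⟩, fun x t => ?_⟩
  · rw [hz]
    exact ⟨hzO', mem_iInter.2 fun i => mem_openStar _ z⟩
  · exact Subtype.ext (AffineMap.lineMap_apply_one _ _)
  · obtain ⟨u, hu, hxu⟩ := SimplicialComplex.mem_space_iff.1 hx
    -- As `x` lies in the star of `z` in `K' i`, a simplex of `L i` that contains `x` contains `z`,
    -- and hence the whole segment.
    have h1 := mem_iInter.1 (he x 0 (mem_univ 0)).2 i
    rw [h0] at h1
    exact SimplicialComplex.convexHull_subset_space hu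
      ((convex_convexHull ℝ _).lineMap_mem hxu (h1 u (hL i hu) hxu) t.2)
  · exact hO'O (he x t (mem_univ t)).1

end Polyhedron

theorem IsSubpolyhedron.isLocallyConical {E : Type*} [AddCommGroup E] [Module ℝ E]
    {K : Geometry.SimplicialComplex ℝ E} {X : Type*} [TopologicalSpace X] (h : Polyhedron K ≃ₜ X)
    {ι : Type*} [Finite ι] {A : ι → Set X} (hA : ∀ i, IsSubpolyhedron h (A i)) :
    IsLocallyConical A := by
  choose K' L hK hL hKL using hA
  refine IsLocallyConical.of_homeomorph h ?_
  convert Polyhedron.isLocallyConical K' L hK hL using 2 with i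
  exact Set.ext (hKL i)

/-! ### From fundamental groups to path homomorphisms and back -/

section Loops

variable {X : Type*} [TopologicalSpace X] {x : X}

theorem loopClass_surjective : Function.Surjective (loopClass (x := x)) := by
  intro a
  obtain ⟨p, hp⟩ := Path.Homotopic.Quotient.mk_surjective (show Path.Homotopic.Quotient x x from a.unop)
  exact ⟨p, congrArg MulOpposite.op hp⟩

theorem loopClass_eq_of_mk_eq {p q : Path x x}
    (h : Path.Homotopic.Quotient.mk p = Path.Homotopic.Quotient.mk q) :
    loopClass p = loopClass q :=
  congrArg (fun a => MulOpposite.op (FundamentalGroup.fromPath a)) h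

namespace PathHom

variable {Q : Type*} [Group Q]

/-- The homomorphism from the fundamental group induced by a path homomorphism. -/
def loopHom (F : PathHom X Q) (x : X) : LoopGroup X x →* Q where
  toFun a := Quotient.lift (fun p : Path x x => F p) (fun _ _ h => F.map_homotopic h)
    (show Path.Homotopic.Quotient x x from a.unop)
  map_one' := F.map_refl x
  map_mul' a b := by
    obtain ⟨p, rfl⟩ := loopClass_surjective a
    obtain ⟨q, rfl⟩ := loopClass_surjective b
    exact F.map_trans p q

@[simp]
theorem loopHom_loopClass (F : PathHom X Q) (p : Path x x) : F.loopHom x (loopClass p) = F p := rfl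

open Classical in
/-- The path homomorphism with values in a fundamental group that is given by joining the base point
to the points of its path component. It is trivial on the other path components. -/
noncomputable def ofJoin (γ : ∀ y, Joined x y → Path x y) : PathHom X (LoopGroup X x) where
  toFun {y z} p := if h : Joined x y then
    loopClass (((γ y h).trans p).trans (γ z (h.trans ⟨p⟩)).symm) else 1
  map_homotopic' {y z p q} h := by
    split_ifs with hy
    · exact loopClass_eq_of_mk_eq (Path.Homotopic.Quotient.eq.2
        (((Path.Homotopic.refl _).hcomp h).hcomp (Path.Homotopic.refl _)))
    · rfl
  map_trans' {y z w} p q := by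
    by_cases hy : Joined x y
    · have hz : Joined x z := hy.trans ⟨p⟩
      rw [dif_pos hy, dif_pos hy, dif_pos hz, ← loopClass_trans]
      refine loopClass_eq_of_mk_eq ?_
      simp only [Path.Homotopic.Quotient.mk_trans, Path.Homotopic.Quotient.mk_symm,
        Path.Homotopic.Quotient.trans_assoc]
      rw [← Path.Homotopic.Quotient.trans_assoc (Path.Homotopic.Quotient.symm _),
        Path.Homotopic.Quotient.symm_trans, Path.Homotopic.Quotient.refl_trans]
    · have hz : ¬ Joined x z := fun h => hy (h.trans ⟨p.symm⟩)
      rw [dif_neg hy, dif_neg hy, dif_neg hz, mul_one]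

theorem ofJoin_loop {γ : ∀ y, Joined x y → Path x y}
    (hγ : (γ x (Joined.refl x)).Homotopic (Path.refl x)) (p : Path x x) :
    ofJoin γ p = loopClass p := by
  simp only [ofJoin, dif_pos (Joined.refl x)]
  refine loopClass_eq_of_mk_eq ?_
  simp only [Path.Homotopic.Quotient.mk_trans, Path.Homotopic.Quotient.mk_symm,
    Path.Homotopic.Quotient.eq.2 hγ]
  simp only [← Path.Homotopic.Quotient.mk_trans, ← Path.Homotopic.Quotient.mk_symm,
    Path.refl_symm, Path.Homotopic.Quotient.eq]
  exact (Path.Homotopic.trans_refl _).trans (Path.Homotopic.refl_trans _)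

theorem ofJoin_join {γ : ∀ y, Joined x y → Path x y}
    (hγ : (γ x (Joined.refl x)).Homotopic (Path.refl x)) {y : X} (hy : Joined x y) :
    ofJoin γ (γ y hy) = 1 := by
  simp only [ofJoin, dif_pos (Joined.refl x)]
  refine (loopClass_eq_of_mk_eq (q := Path.refl x) (Path.Homotopic.Quotient.eq.2 ?_)).trans rfl
  exact (((hγ.hcomp (Path.Homotopic.refl _)).trans (Path.Homotopic.refl_trans _)).hcomp
    (Path.Homotopic.refl _)).trans (Path.Homotopic.trans_symm _)

/-- There is a path homomorphism with values in a fundamental group that extends the class of a loop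
and is trivial on prescribed paths from the base point to the points of disjoint sets. -/
theorem exists_eq_loopClass {ι : Type*} {D : ι → Set X}
    (hD : ∀ i j y, y ∈ D i → y ∈ D j → i = j) (κ : ∀ i (y : D i), Path x (y : X)) (i₀ : ι)
    (h₀ : x ∈ D i₀) (hκ : (κ i₀ ⟨x, h₀⟩).Homotopic (Path.refl x)) :
    ∃ U : PathHom X (LoopGroup X x), (∀ p : Path x x, U p = loopClass p) ∧
      ∀ i (y : D i), U (κ i y) = 1 := by
  classical
  -- The prescribed paths are used as joining paths wherever they exist; disjointness of the `D i`
  -- makes this unambiguous.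
  let γ : ∀ y, Joined x y → Path x y := fun y hy =>
    if h : ∃ i, y ∈ D i then κ h.choose ⟨y, h.choose_spec⟩ else hy.somePath
  have hγ : ∀ i (y : D i) (hy : Joined x y), γ y hy = κ i y := by
    intro i y hy
    have h : ∃ i, (y : X) ∈ D i := ⟨i, y.2⟩
    have key : ∀ j (hj : (y : X) ∈ D j), κ j ⟨y, hj⟩ = κ i y := by
      intro j hj
      obtain rfl := hD i j y y.2 hj
      rfl
    simp only [γ, dif_pos h]
    exact key _ _
  have h1 : (γ x (Joined.refl x)).Homotopic (Path.refl x) := by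
    rw [hγ i₀ ⟨x, h₀⟩]; exact hκ
  refine ⟨ofJoin γ, ofJoin_loop h1, fun i y => ?_⟩
  rw [← hγ i y ⟨κ i y⟩]
  exact ofJoin_join h1 _

end PathHom

end Loops

theorem IsTopDisjointUnion.eq_of_mem {X ι : Type*} [TopologicalSpace X] {S : Set X}
    {C : ι → Set X} (h : IsTopDisjointUnion S C) {i j : ι} {x : X} (hi : x ∈ C i) (hj : x ∈ C j) :
    i = j := by
  by_contra hij
  exact (h.disjoint hij).le_bot ⟨hi, hj⟩

/-- The pieces are open in `S`, so the index of the piece containing `p t` is locally constant on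
the interval. -/
theorem IsTopDisjointUnion.path_mem {X ι : Type*} [TopologicalSpace X] {S : Set X}
    {C : ι → Set X} (h : IsTopDisjointUnion S C) {x y : X} (p : Path x y) (hp : ∀ t, p t ∈ S) :
    ∃ i, ∀ t, p t ∈ C i := by
  have hex : ∀ t, ∃ i, p t ∈ C i := fun t => by simpa [← h.iUnion_eq] using hp t
  choose k hk using hex
  have hloc : IsLocallyConstant k := by
    rw [IsLocallyConstant.iff_eventually_eq]
    intro t
    have hc : Continuous fun t => (⟨p t, hp t⟩ : S) := p.continuous.subtype_mk _
    filter_upwards [((h.isOpen (k t)).preimage hc).mem_nhds (hk t)] with s hs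
    exact h.eq_of_mem (hk s) hs
  exact ⟨k 0, fun t => hloc.apply_eq_of_preconnectedSpace t 0 ▸ hk t⟩

/-! ### The universal property of the fundamental group of a union -/

section VanKampen

variable {X : Type*} [TopologicalSpace X] {A B : Set X} {n : ℕ} {C : Fin (n + 1) → Set X}

/-- There is a path homomorphism with values in a fundamental group that extends the class of a
loop. -/
theorem PathHom.exists_forall_eq_loopClass (x : X) :
    ∃ U : PathHom X (LoopGroup X x), ∀ p : Path x x, U p = loopClass p := by
  obtain ⟨U, hU, -⟩ := PathHom.exists_eq_loopClass (x := x) (D := fun _ : Unit => {x})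
    (fun _ _ _ _ _ => rfl) (fun _ y => (Path.refl x).cast rfl y.2) () rfl (Path.Homotopic.refl _)
  exact ⟨U, hU⟩

/-- The joining path to a point of `C i` is `t i` followed by `δ i`. Using the same `δ` for `A` and
for `B` assigns to a path in `C i` the images of one and the same element under the two inclusions
along `t i`. -/
theorem exists_pathHom_inclusionAlong {S : Set X} (hC : IsTopDisjointUnion S C)
    (hCA : ∀ i, C i ⊆ A) (c : ∀ i, C i) (δ : ∀ i (x : C i), Path (c i) x)
    (hδ : ∀ i, (δ i (c i)).Homotopic (Path.refl _))
    (t : ∀ i, Path (inclusion (hCA 0) (c 0)) (inclusion (hCA i) (c i))) (ht : t 0 = Path.refl _) :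
    ∃ U : PathHom A (LoopGroup A (inclusion (hCA 0) (c 0))), (∀ p, U p = loopClass p) ∧
      (∀ i, U (t i) = 1) ∧ ∀ i {x y : C i} (p : Path x y),
        U (p.map (continuous_inclusion (hCA i))) =
          LoopGroup.inclusionAlong (hCA i) (c i) (t i)
            (loopClass (((δ i x).trans p).trans (δ i y).symm)) := by
  obtain ⟨U, hU, hU1⟩ := PathHom.exists_eq_loopClass (D := fun i => ((↑) : A → X) ⁻¹' C i)
    (fun i j y hi hj => hC.eq_of_mem hi hj)
    (fun i y => (t i).trans ((δ i ⟨y.1.1, y.2⟩).map (continuous_inclusion (hCA i))))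
    0 (c 0).2 (by
      rw [ht]
      exact (Path.Homotopic.refl_trans _).trans ((hδ 0).map ⟨_, continuous_inclusion (hCA 0)⟩))
  have hδ1 : ∀ i, U ((δ i (c i)).map (continuous_inclusion (hCA i))) = 1 := fun i =>
    (U.map_homotopic ((hδ i).map ⟨_, continuous_inclusion (hCA i)⟩)).trans (U.map_refl _)
  have hmul : ∀ i (x : C i), U (t i) * U ((δ i x).map (continuous_inclusion (hCA i))) = 1 :=
    fun i x => (U.map_trans _ _).symm.trans (hU1 i ⟨inclusion (hCA i) x, x.2⟩)
  have ht1 : ∀ i, U (t i) = 1 := fun i => by simpa [hδ1] using hmul i (c i)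
  have hδ2 : ∀ i (x : C i), U ((δ i x).map (continuous_inclusion (hCA i))) = 1 := fun i x => by
    simpa [ht1] using hmul i x
  refine ⟨U, hU, ht1, fun i x y p => ?_⟩
  rw [LoopGroup.inclusionAlong_loopClass, ← hU]
  simp only [Path.map_trans, ← Path.map_symm, U.map_trans, U.map_symm, ht1, hδ2]
  simp

variable (hC : IsTopDisjointUnion (A ∩ B) C) (c : ∀ i, C i)
  (tA : ∀ i, Path (inclusion (hC.subset_left 0) (c 0)) (inclusion (hC.subset_left i) (c i)))
  (tB : ∀ i, Path (inclusion (hC.subset_right 0) (c 0)) (inclusion (hC.subset_right i) (c i)))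

/-- The images in the fundamental group of a union of a loop in the intersection. -/
theorem LoopGroup.ofSubset_inclusionAlong (i : Fin (n + 1)) (s : LoopGroup (C i) (c i)) :
    LoopGroup.ofSubset A (inclusion (hC.subset_left 0) (c 0))
        (LoopGroup.inclusionAlong (hC.subset_left i) (c i) (tA i) s) =
      loopClass (((tA i).map continuous_subtype_val).trans
          ((tB i).map continuous_subtype_val).symm) *
        LoopGroup.ofSubset B (inclusion (hC.subset_right 0) (c 0))
          (LoopGroup.inclusionAlong (hC.subset_right i) (c i) (tB i) s) *
        (loopClass (((tA i).map continuous_subtype_val).trans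
          ((tB i).map continuous_subtype_val).symm))⁻¹ := by
  obtain ⟨p, rfl⟩ := loopClass_surjective s
  obtain ⟨U, hU⟩ := PathHom.exists_forall_eq_loopClass (c 0 : X)
  let UA : PathHom A (LoopGroup X (c 0 : X)) := U.comap continuous_subtype_val
  let UB : PathHom B (LoopGroup X (c 0 : X)) := U.comap continuous_subtype_val
  have hA : ∀ q, LoopGroup.ofSubset A (inclusion (hC.subset_left 0) (c 0)) (loopClass q) = UA q :=
    fun q => (hU _).symm
  have hB : ∀ q, LoopGroup.ofSubset B (inclusion (hC.subset_right 0) (c 0)) (loopClass q) = UB q :=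
    fun q => (hU _).symm
  have hT : loopClass (((tA i).map continuous_subtype_val).trans
      ((tB i).map continuous_subtype_val).symm) = UA (tA i) * (UB (tB i))⁻¹ := by
    rw [← hU, U.map_trans, U.map_symm]; rfl
  have hp : UA (p.map (continuous_inclusion (hC.subset_left i))) =
    UB (p.map (continuous_inclusion (hC.subset_right i))) := rfl
  rw [LoopGroup.inclusionAlong_loopClass, LoopGroup.inclusionAlong_loopClass, hA, hB, hT]
  simp only [PathHom.map_trans, PathHom.map_symm, hp]
  group

/-- Existence part of the universal property of the fundamental group of a union. -/
theorem LoopGroup.exists_hom_of_union (hconic : IsLocallyConical fun b : Bool => cond b A B)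
    (hAB : A ∪ B = univ) (hCpath : ∀ i, IsPathConnected (C i)) (htA : tA 0 = Path.refl _)
    (htB : tB 0 = Path.refl _) {Q : Type*} [Group Q]
    (a : LoopGroup A (inclusion (hC.subset_left 0) (c 0)) →* Q)
    (b : LoopGroup B (inclusion (hC.subset_right 0) (c 0)) →* Q) (τ : Fin (n + 1) → Q)
    (hτ : τ 0 = 1)
    (hrel : ∀ i s, a (LoopGroup.inclusionAlong (hC.subset_left i) (c i) (tA i) s) =
      τ i * b (LoopGroup.inclusionAlong (hC.subset_right i) (c i) (tB i) s) * (τ i)⁻¹) :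
    ∃ ψ : LoopGroup X (c 0 : X) →* Q,
      (∀ α, ψ (LoopGroup.ofSubset A (inclusion (hC.subset_left 0) (c 0)) α) = a α) ∧
      (∀ β, ψ (LoopGroup.ofSubset B (inclusion (hC.subset_right 0) (c 0)) β) = b β) ∧
      ∀ i, ψ (loopClass (((tA i).map continuous_subtype_val).trans
        ((tB i).map continuous_subtype_val).symm)) = τ i := by
  classical
  have hconn : ∀ i, PathConnectedSpace (C i) := fun i =>
    isPathConnected_iff_pathConnectedSpace.1 (hCpath i)
  -- The initial reversed loop makes `δ i (c i)` null-homotopic, whatever loop `somePath` picks at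
  -- `c i`.
  let δ : ∀ i (x : C i), Path (c i) x := fun i x =>
    (PathConnectedSpace.somePath (c i) (c i)).symm.trans (PathConnectedSpace.somePath (c i) x)
  have hδ : ∀ i, (δ i (c i)).Homotopic (Path.refl _) := fun i => Path.Homotopic.symm_trans _
  obtain ⟨UA, hUA, hUAt, hUAC⟩ :=
    exists_pathHom_inclusionAlong hC hC.subset_left c δ hδ tA htA
  obtain ⟨UB, hUB, hUBt, hUBC⟩ :=
    exists_pathHom_inclusionAlong hC hC.subset_right c δ hδ tB htB
  let θ : X → Q := fun x => if h : ∃ i, x ∈ C i then τ h.choose else 1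
  have hθ : ∀ i {x}, x ∈ C i → θ x = τ i := by
    intro i x hx
    have h : ∃ i, x ∈ C i := ⟨i, hx⟩
    simp only [θ, dif_pos h]
    rw [hC.eq_of_mem h.choose_spec hx]
  let FA : PathHom A Q := UA.comp a
  -- On `C i` the relation makes the two functors differ by conjugation with `τ i`, which this
  -- coboundary removes. At `c 0` it is trivial because `τ 0 = 1`.
  let FB : PathHom B Q := (UB.comp b).gauge fun x => θ x
  have key : ∀ {x y : X} (p : Path x y) (hpA : ∀ t, p t ∈ A) (hpB : ∀ t, p t ∈ B),
      FA (p.codRestrict hpA) = FB (p.codRestrict hpB) := by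
    intro x y p hpA hpB
    obtain ⟨i, hi⟩ := hC.path_mem p fun t => ⟨hpA t, hpB t⟩
    have h1 := hUAC i (p.codRestrict hi)
    have h2 := hUBC i (p.codRestrict hi)
    have h3 : FA (p.codRestrict hpA) = a (UA ((p.codRestrict hi).map
      (continuous_inclusion (hC.subset_left i)))) := rfl
    have h4 : FB (p.codRestrict hpB) = θ x * b (UB ((p.codRestrict hi).map
      (continuous_inclusion (hC.subset_right i)))) * (θ y)⁻¹ := rfl
    rw [h3, h4, h1, h2, hrel, hθ i (by simpa using hi 0), hθ i (by simpa using hi 1)]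
  obtain ⟨G, hG⟩ := hconic.exists_pathHom
    (fun x => (hAB.symm ▸ mem_univ x : x ∈ A ∪ B).elim (fun h => ⟨true, h⟩) fun h => ⟨false, h⟩)
    (fun b => match b with
      | true => FA
      | false => FB) (fun i j x y p hi hj => match i, j with
      | true, true => rfl
      | false, false => rfl
      | true, false => key p hi hj
      | false, true => (key p hj hi).symm)
  have hGA : ∀ {x y : A} (p : Path x y), G (p.map continuous_subtype_val) = FA p := hG true
  have hGB : ∀ {x y : B} (p : Path x y), G (p.map continuous_subtype_val) = FB p := hG false
  refine ⟨G.loopHom _, fun α => ?_, fun β => ?_, fun i => ?_⟩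
  · obtain ⟨p, rfl⟩ := loopClass_surjective α
    rw [LoopGroup.ofSubset_loopClass]
    exact (hGA p).trans (congrArg a (hUA p))
  · obtain ⟨p, rfl⟩ := loopClass_surjective β
    rw [LoopGroup.ofSubset_loopClass]
    refine (hGB p).trans ?_
    simp only [FB, PathHom.gauge_apply, PathHom.comp_apply, hUB]
    simp [hθ 0 (c 0).2, hτ]
  · rw [PathHom.loopHom_loopClass, G.map_trans, G.map_symm, hGA, hGB]
    simp only [FA, FB, PathHom.gauge_apply, PathHom.comp_apply, hUAt, hUBt]
    simp [hθ 0 (c 0).2, hτ, hθ i (c i).2]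

/-- Uniqueness part of the universal property of the fundamental group of a union. -/
theorem LoopGroup.hom_ext_of_union (hconic : IsLocallyConical fun b : Bool => cond b A B)
    (hAB : A ∪ B = univ) (hCpath : ∀ i, IsPathConnected (C i)) {Q : Type*} [Group Q]
    (φ ψ : LoopGroup X (c 0 : X) →* Q)
    (hA : ∀ α, φ (LoopGroup.ofSubset A (inclusion (hC.subset_left 0) (c 0)) α) =
      ψ (LoopGroup.ofSubset A (inclusion (hC.subset_left 0) (c 0)) α))
    (hB : ∀ β, φ (LoopGroup.ofSubset B (inclusion (hC.subset_right 0) (c 0)) β) =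
      ψ (LoopGroup.ofSubset B (inclusion (hC.subset_right 0) (c 0)) β))
    (ht : ∀ i, φ (loopClass (((tA i).map continuous_subtype_val).trans
        ((tB i).map continuous_subtype_val).symm)) =
      ψ (loopClass (((tA i).map continuous_subtype_val).trans
        ((tB i).map continuous_subtype_val).symm))) : φ = ψ := by
  have hcov : ∀ x, ∃ b : Bool, x ∈ cond b A B := fun x =>
    (hAB.symm ▸ mem_univ x : x ∈ A ∪ B).elim (fun h => ⟨true, h⟩) fun h => ⟨false, h⟩
  have hconn : ∀ i, PathConnectedSpace (C i) := fun i =>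
    isPathConnected_iff_pathConnectedSpace.1 (hCpath i)
  obtain ⟨U, hU⟩ := PathHom.exists_forall_eq_loopClass (c 0 : X)
  let UA : PathHom A (LoopGroup X (c 0 : X)) := U.comap continuous_subtype_val
  let UB : PathHom B (LoopGroup X (c 0 : X)) := U.comap continuous_subtype_val
  let H := φ.eqLocus ψ
  have hAH : ∀ p : Path (inclusion (hC.subset_left 0) (c 0)) _, UA p ∈ H := fun p => by
    have := hA (loopClass p)
    rw [LoopGroup.ofSubset_loopClass, ← hU] at this
    exact this
  have hBH : ∀ p : Path (inclusion (hC.subset_right 0) (c 0)) _, UB p ∈ H := fun p => by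
    have := hB (loopClass p)
    rw [LoopGroup.ofSubset_loopClass, ← hU] at this
    exact this
  have htH : ∀ i, UA (tA i) * (UB (tB i))⁻¹ ∈ H := fun i => by
    have := ht i
    rw [← hU, U.map_trans, U.map_symm] at this
    exact this
  let pA : ∀ i (x : C i), Path (inclusion (hC.subset_left 0) (c 0)) (inclusion (hC.subset_left i) x) :=
    fun i x => (tA i).trans
      ((PathConnectedSpace.somePath (c i) x).map (continuous_inclusion (hC.subset_left i)))
  let pB : ∀ i (x : C i),
      Path (inclusion (hC.subset_right 0) (c 0)) (inclusion (hC.subset_right i) x) :=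
    fun i x => (tB i).trans
      ((PathConnectedSpace.somePath (c i) x).map (continuous_inclusion (hC.subset_right i)))
  have hpH : ∀ i (x : C i), UA (pA i x) * (UB (pB i x))⁻¹ ∈ H := by
    intro i x
    have h : UA ((PathConnectedSpace.somePath (c i) x).map
      (continuous_inclusion (hC.subset_left i))) = UB ((PathConnectedSpace.somePath (c i) x).map
        (continuous_inclusion (hC.subset_right i))) := rfl
    simp only [pA, pB, UA.map_trans, UB.map_trans, h, mul_inv_rev]
    rw [mul_assoc, mul_inv_cancel_left]
    exact htH i
  have hmemC : ∀ {x}, x ∈ A → x ∈ B → ∃ i, x ∈ C i := fun {x} h1 h2 =>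
    mem_iUnion.1 (hC.iUnion_eq.symm ▸ (⟨h1, h2⟩ : x ∈ A ∩ B) : x ∈ ⋃ i, C i)
  -- Neither `A` nor `B` is assumed path connected, but any of their points in the path component of
  -- `c 0` in `X` can be reached from `c 0` inside the same set.
  have hjoin : ∀ {x}, Joined (c 0 : X) x → ∀ {b : Bool}, x ∈ cond b A B →
      JoinedIn (cond b A B) (c 0 : X) x := by
    intro x hx b hb
    refine hconic.joined hcov ?_ ?_ hx hb
    · exact Bool.forall_bool.2 ⟨hC.subset_right 0 (c 0).2, hC.subset_left 0 (c 0).2⟩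
    · have hl : ∀ x, x ∈ A → x ∈ B → JoinedIn A (c 0 : X) x ∧ JoinedIn B (c 0 : X) x := by
        intro x h1 h2
        obtain ⟨i, hi⟩ := hmemC h1 h2
        exact ⟨⟨(pA i ⟨x, hi⟩).map continuous_subtype_val, fun t => (pA i ⟨x, hi⟩ t).2⟩,
          ⟨(pB i ⟨x, hi⟩).map continuous_subtype_val, fun t => (pB i ⟨x, hi⟩ t).2⟩⟩
      rintro (_ | _) (_ | _) hij x ⟨h1, h2⟩
      · exact absurd rfl hij
      · exact (hl x h2 h1).2
      · exact (hl x h1 h2).1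
      · exact absurd rfl hij
  -- The element `e x` represents, modulo left multiplication by `H`, a path from `c 0` to `x` in
  -- `A` and one in `B`, where available. On `A ∩ B` both are possible because `UA (tA i) * (UB (tB
  -- i))⁻¹` lies in `H`. After gauging by `e`, paths in `A` or `B` that lie in the component of `c
  -- 0` take values in `H`.
  have hε : ∀ x, ∃ e : LoopGroup X (c 0 : X), Joined (c 0 : X) x →
      (∀ hx : x ∈ A, ∃ α : Path (inclusion (hC.subset_left 0) (c 0)) ⟨x, hx⟩, e * (UA α)⁻¹ ∈ H) ∧
      ∀ hx : x ∈ B, ∃ β : Path (inclusion (hC.subset_right 0) (c 0)) ⟨x, hx⟩,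
        e * (UB β)⁻¹ ∈ H := by
    intro x
    by_cases hx : Joined (c 0 : X) x
    swap
    · exact ⟨1, fun h => absurd h hx⟩
    by_cases hxA : x ∈ A
    · by_cases hxB : x ∈ B
      · obtain ⟨i, hi⟩ := hmemC hxA hxB
        refine ⟨UA (pA i ⟨x, hi⟩), fun _ => ⟨fun _ => ⟨pA i ⟨x, hi⟩, ?_⟩,
          fun _ => ⟨pB i ⟨x, hi⟩, hpH i _⟩⟩⟩
        rw [mul_inv_cancel]
        exact H.one_mem
      · obtain ⟨p⟩ := (hjoin hx (b := true) hxA).joined_subtype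
        refine ⟨UA p, fun _ => ⟨fun _ => ⟨p, ?_⟩, fun h => absurd h hxB⟩⟩
        rw [mul_inv_cancel]
        exact H.one_mem
    · have hxB : x ∈ B := (hAB.symm ▸ mem_univ x : x ∈ A ∪ B).resolve_left hxA
      obtain ⟨p⟩ := (hjoin hx (b := false) hxB).joined_subtype
      refine ⟨UB p, fun _ => ⟨fun h => absurd h hxA, fun _ => ⟨p, ?_⟩⟩⟩
      rw [mul_inv_cancel]
      exact H.one_mem
  choose e he using hε
  have conj_mem : ∀ {u v α β p : LoopGroup X (c 0 : X)}, u * α⁻¹ ∈ H → v * β⁻¹ ∈ H →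
      α * p * β⁻¹ ∈ H → u * p * v⁻¹ ∈ H := by
    intro u v α β p h1 h2 h3
    have := H.mul_mem (H.mul_mem h1 h3) (H.inv_mem h2)
    convert this using 1
    group
  have hmain : ∀ p : Path (c 0 : X) (c 0), φ (e (c 0) * U p * (e (c 0))⁻¹) =
      ψ (e (c 0) * U p * (e (c 0))⁻¹) := by
    refine hconic.pathHom_eq hcov ((U.gauge e).comp φ) ((U.gauge e).comp ψ) ?_
    have hA' : ∀ {x y : A} (p : Path x y), Joined (c 0 : X) x → e x * UA p * (e y)⁻¹ ∈ H := by
      intro x y p hx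
      obtain ⟨α, hα⟩ := (he x hx).1 x.2
      obtain ⟨β, hβ⟩ := (he y (hx.trans ⟨p.map continuous_subtype_val⟩)).1 y.2
      refine conj_mem hα hβ ?_
      have := hAH ((α.trans p).trans β.symm)
      rwa [UA.map_trans, UA.map_trans, UA.map_symm] at this
    have hB' : ∀ {x y : B} (p : Path x y), Joined (c 0 : X) x → e x * UB p * (e y)⁻¹ ∈ H := by
      intro x y p hx
      obtain ⟨α, hα⟩ := (he x hx).2 x.2
      obtain ⟨β, hβ⟩ := (he y (hx.trans ⟨p.map continuous_subtype_val⟩)).2 y.2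
      refine conj_mem hα hβ ?_
      have := hBH ((α.trans p).trans β.symm)
      rwa [UB.map_trans, UB.map_trans, UB.map_symm] at this
    rintro (_ | _) x y p hx
    · exact hB' p hx
    · exact hA' p hx
  -- The gauge at the base point lies in `H`, so it cancels from the conjugated equation.
  have he0 : e (c 0) ∈ H := by
    obtain ⟨α, hα⟩ := (he (c 0) (Joined.refl _)).1 (hC.subset_left 0 (c 0).2)
    have := H.mul_mem hα (hAH α)
    rwa [inv_mul_cancel_right] at this
  ext a
  obtain ⟨p, rfl⟩ := loopClass_surjective a
  have h := hmain p
  rw [hU] at h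
  simp only [map_mul, map_inv, show φ (e (c 0)) = ψ (e (c 0)) from he0] at h
  simpa using h

end VanKampen

end Gluing

/-! ### The isomorphism -/

theorem mainTheorem3 {X : Type*} [TopologicalSpace X] {E : Type*} [AddCommGroup E] [Module ℝ E]
    (K : Geometry.SimplicialComplex ℝ E) (h : Polyhedron K ≃ₜ X)
    (A B : Set X) (hA : IsSubpolyhedron h A) (hB : IsSubpolyhedron h B) (hAB : A ∪ B = univ)
    (n : ℕ) (C : Fin (n + 1) → Set X) (hC : IsTopDisjointUnion (A ∩ B) C)
    (hCpath : ∀ i, IsPathConnected (C i)) (c : ∀ i, C i)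
    (tA : ∀ i : Fin n,
      Path (inclusion (hC.subset_left 0) (c 0)) (inclusion (hC.subset_left i.succ) (c i.succ)))
    (tB : ∀ i : Fin n,
      Path (inclusion (hC.subset_right 0) (c 0)) (inclusion (hC.subset_right i.succ) (c i.succ))) :
    ∃ Φ : VKProduct (LoopGroup A (inclusion (hC.subset_left 0) (c 0)))
          (LoopGroup B (inclusion (hC.subset_right 0) (c 0))) n ⧸
          Subgroup.normalClosure (VKProduct.relators
            (fun i => LoopGroup.inclusionAlong (hC.subset_left i) (c i)
              (pathsWithConst (c := fun i => inclusion (hC.subset_left i) (c i)) tA i))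
            (fun i => LoopGroup.inclusionAlong (hC.subset_right i) (c i)
              (pathsWithConst (c := fun i => inclusion (hC.subset_right i) (c i)) tB i))) ≃*
        LoopGroup X (c 0 : X),
      (∀ α, Φ (QuotientGroup.mk (Monoid.Coprod.inl (Monoid.Coprod.inl α))) =
        LoopGroup.ofSubset A (inclusion (hC.subset_left 0) (c 0)) α) ∧
      (∀ β, Φ (QuotientGroup.mk (Monoid.Coprod.inl (Monoid.Coprod.inr β))) =
        LoopGroup.ofSubset B (inclusion (hC.subset_right 0) (c 0)) β) ∧
      (∀ i : Fin n, Φ (QuotientGroup.mk (Monoid.Coprod.inr (FreeGroup.of i))) =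
        loopClass (((tA i).map continuous_subtype_val).trans
          ((tB i).map continuous_subtype_val).symm)) := by
  have hconic : IsLocallyConical fun b : Bool => cond b A B :=
    IsSubpolyhedron.isLocallyConical h (Bool.forall_bool.2 ⟨hB, hA⟩)
  let sA := pathsWithConst (c := fun i => inclusion (hC.subset_left i) (c i)) tA
  let sB := pathsWithConst (c := fun i => inclusion (hC.subset_right i) (c i)) tB
  let jA := fun i => LoopGroup.inclusionAlong (hC.subset_left i) (c i) (sA i)
  let jB := fun i => LoopGroup.inclusionAlong (hC.subset_right i) (c i) (sB i)
  let iA := LoopGroup.ofSubset A (inclusion (hC.subset_left 0) (c 0))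
  let iB := LoopGroup.ofSubset B (inclusion (hC.subset_right 0) (c 0))
  let T : Fin (n + 1) → LoopGroup X (c 0 : X) := fun i =>
    loopClass (((sA i).map continuous_subtype_val).trans ((sB i).map continuous_subtype_val).symm)
  let N := Subgroup.normalClosure (VKProduct.relators jA jB)
  let φ : VKProduct (LoopGroup A (inclusion (hC.subset_left 0) (c 0)))
      (LoopGroup B (inclusion (hC.subset_right 0) (c 0))) n →* LoopGroup X (c 0 : X) :=
    Monoid.Coprod.lift (Monoid.Coprod.lift iA iB) (FreeGroup.lift fun i => T i.succ)
  have hT0 : T 0 = 1 := loopClass_eq_of_mk_eq (Path.Homotopic.Quotient.eq.2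
    (Path.Homotopic.trans_symm ((Path.refl _).map continuous_subtype_val)))
  have hφt : ∀ i, φ (VKProduct.t _ _ i) = T i := by
    refine Fin.cases ?_ fun i => ?_
    · rw [hT0]; exact map_one φ
    · simp [φ, VKProduct.t]
  have hker : N ≤ φ.ker := by
    refine Subgroup.normalClosure_le_normal ?_
    rintro _ ⟨i, a, rfl⟩
    rw [SetLike.mem_coe, MonoidHom.mem_ker, map_mul, map_inv, map_mul, map_mul, map_inv, hφt,
      mul_inv_eq_one]
    simp only [φ, Monoid.Coprod.lift_apply_inl, Monoid.Coprod.lift_apply_inr]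
    exact LoopGroup.ofSubset_inclusionAlong hC c sA sB i a
  let Φ : _ ⧸ N →* LoopGroup X (c 0 : X) := QuotientGroup.lift N φ hker
  let π := QuotientGroup.mk' N
  -- The quotient itself satisfies the relations, so the universal property yields the candidate
  -- inverse `ψ`.
  obtain ⟨ψ, hψA, hψB, hψT⟩ := LoopGroup.exists_hom_of_union hC c sA sB hconic hAB hCpath rfl rfl
    (π.comp (Monoid.Coprod.inl.comp Monoid.Coprod.inl))
    (π.comp (Monoid.Coprod.inl.comp Monoid.Coprod.inr)) (fun i => π (VKProduct.t _ _ i))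
    (map_one π) fun i a => by
      have : π (Monoid.Coprod.inl (Monoid.Coprod.inl (jA i a)) * (VKProduct.t _ _ i *
          Monoid.Coprod.inl (Monoid.Coprod.inr (jB i a)) * (VKProduct.t _ _ i)⁻¹)⁻¹) = 1 :=
        (QuotientGroup.eq_one_iff _).2 (Subgroup.subset_normalClosure ⟨i, a, rfl⟩)
      rw [map_mul, map_inv, mul_inv_eq_one, map_mul, map_mul, map_inv] at this
      exact this
  have h1 : ψ.comp Φ = MonoidHom.id _ := by
    refine QuotientGroup.monoidHom_ext _ (Monoid.Coprod.hom_ext (Monoid.Coprod.hom_ext ?_ ?_) ?_)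
    · ext1 α
      exact (congrArg ψ (by simp [Φ, φ, iA])).trans (hψA α)
    · ext1 β
      exact (congrArg ψ (by simp [Φ, φ, iB])).trans (hψB β)
    · refine FreeGroup.ext_hom _ _ fun i => ?_
      exact (congrArg ψ (by simp [Φ, φ, T])).trans (hψT i.succ)
  have h2 : Φ.comp ψ = MonoidHom.id _ := by
    refine LoopGroup.hom_ext_of_union hC c sA sB hconic hAB hCpath _ _ (fun α => ?_) (fun β => ?_)
      fun i => ?_
    · exact (congrArg Φ (hψA α)).trans (by simp [Φ, φ, π, iA])
    · exact (congrArg Φ (hψB β)).trans (by simp [Φ, φ, π, iB])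
    · exact (congrArg Φ (hψT i)).trans (hφt i)
  refine ⟨Φ.toMulEquiv ψ h1 h2, fun α => ?_, fun β => ?_, fun i => ?_⟩
  · exact (by simp [φ, iA] : φ (Monoid.Coprod.inl (Monoid.Coprod.inl α)) = iA α)
  · exact (by simp [φ, iB] : φ (Monoid.Coprod.inl (Monoid.Coprod.inr β)) = iB β)
  · exact (by simp [φ] : φ (Monoid.Coprod.inr (FreeGroup.of i)) = T i.succ)
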